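/- A curve in a metric space $(X,d)$ is a continuous map $\gamma:[0,1]\to X$; its length is the supremum of $\sum_k d(\gamma(t_{k-1}),\gamma(t_k))$ over all subdivisions of $[0,1]$, and it is rectifiable if its length is finite. $(X,d)$ is geodesic if every two points $x,y\in X$ are joined by a curve of length $d(x,y)$. A geodesic is a rectifiable curve $\gamma:[0,1]\to X$ that is locally minimizing (every parameter has a neighbourhood in which the length of each subarc equals the distance between its endpoints) and has constant speed; it is minimal if its length is $d(\gamma(0),\gamma(1))$. A geodesic metric space $(X,d)$ is an Alexandrov space of nonnegative curvature if, for all $x,y,z\in X$ and every minimal geodesic $\gamma:[0,1]\to X$ from $y$ to $z$, \[ d\bigl(x,\gamma(\tfrac12)\bigr)^2\ \ge\ \tfrac12 d(x,y)^2+\tfrac12 d(x,z)^2-\tfrac14 d(y,z)^2 . \] **Corollary.** Every Alexandrov space $(X,d)$ of nonnegative curvature has Enflo type $2$: there is a constant $K\ge 1$ such that for every $N\in\mathbb N$ and every family $(x_\varepsilon)_{\varepsilon\in\{-1,1\}^N}$ of points of $X$, \[ \sum_{\varepsilon\in\{-1,1\}^N} d(x_\varepsilon,x_{-\varepsilon})^2\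 \le\ K^2\sum_{\varepsilon\sim\varepsilon'} d(x_\varepsilon,x_{\varepsilon'})^2 , \] where the sum on the right is over all ordered pairs $(\varepsilon,\varepsilon')$ of elements of $\{-1,1\}^N$ with $\sum_{i=1}^N|\varepsilon_i-\varepsilon_i'|=2$. -/

import Mathlib

/-- The length of a curve `γ : [0,1] → X` (values of `γ` outside `[0,1]` are irrelevant):
the supremum of the lengths of inscribed polygons. -/
noncomputable def curveLength {X : Type*} [MetricSpace X] (γ : ℝ → X) : ENNReal :=
  eVariationOn γ (Set.Icc 0 1)

/-- `X` is a geodesic metric space: every two points are joined by a (continuous) curve whose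
length is their distance. -/
def IsGeodesicSpace (X : Type*) [MetricSpace X] : Prop :=
  ∀ x y : X, ∃ γ : ℝ → X, ContinuousOn γ (Set.Icc 0 1) ∧ γ 0 = x ∧ γ 1 = y ∧
    curveLength γ = edist x y

/-- `γ` is locally minimizing on `[0,1]`: around every parameter, the length of each short
subarc is the distance between its endpoints. -/
def IsLocallyMinimizing {X : Type*} [MetricSpace X] (γ : ℝ → X) : Prop :=
  ∀ t ∈ Set.Icc (0 : ℝ) 1, ∃ δ > 0, ∀ a ∈ Set.Icc (0 : ℝ) 1, ∀ b ∈ Set.Icc (0 : ℝ) 1,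
    |a - t| < δ → |b - t| < δ → a ≤ b → eVariationOn γ (Set.Icc a b) = edist (γ a) (γ b)

/-- A geodesic `γ : [0,1] → X`: a rectifiable curve which is locally minimizing and has
constant speed. -/
structure IsGeodesicCurve {X : Type*} [MetricSpace X] (γ : ℝ → X) : Prop where
  continuousOn : ContinuousOn γ (Set.Icc 0 1)
  rectifiable : curveLength γ ≠ ⊤
  locallyMinimizing : IsLocallyMinimizing γ
  constantSpeed : ∃ v : NNReal, HasConstantSpeedOnWith γ (Set.Icc 0 1) v

/-- A minimal geodesic: a geodesic whose length is the distance between its endpoints. -/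
structure IsMinimalGeodesic {X : Type*} [MetricSpace X] (γ : ℝ → X) : Prop where
  isGeodesicCurve : IsGeodesicCurve γ
  length_eq : curveLength γ = edist (γ 0) (γ 1)

/-- Alexandrov spaces of nonnegative curvature. -/
structure IsAlexandrovNonneg (X : Type*) [MetricSpace X] : Prop where
  isGeodesicSpace : IsGeodesicSpace X
  midpoint_le : ∀ (x y z : X) (γ : ℝ → X), IsMinimalGeodesic γ → γ 0 = y → γ 1 = z →
    dist x (γ (1 / 2)) ^ 2 ≥
      (1 / 2) * dist x y ^ 2 + (1 / 2) * dist x z ^ 2 - (1 / 4) * dist y z ^ 2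

/-- Adjacency of two vertices `ε, ε'` of the discrete cube `{-1,1}^N`:
`∑ i, |ε i - ε' i| = 2`. The group `ℤˣ` of units of `ℤ` is `{-1,1}`. -/
def CubeAdj {N : ℕ} (ε ε' : Fin N → ℤˣ) : Prop :=
  ∑ i, |(ε i : ℤ) - (ε' i : ℤ)| = 2

instance {N : ℕ} (ε ε' : Fin N → ℤˣ) : Decidable (CubeAdj ε ε') :=
  inferInstanceAs (Decidable (∑ i, |(ε i : ℤ) - (ε' i : ℤ)| = 2))

/-- Enflo type 2. The sum on the right runs over all ordered pairs of adjacent vertices. -/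
def HasEnfloTypeTwo (X : Type*) [MetricSpace X] : Prop :=
  ∃ K : ℝ, 1 ≤ K ∧ ∀ (N : ℕ) (x : (Fin N → ℤˣ) → X),
    ∑ ε, dist (x ε) (x (-ε)) ^ 2 ≤
      K ^ 2 * ∑ ε, ∑ ε', if CubeAdj ε ε' then dist (x ε) (x ε') ^ 2 else 0

/-! Nonnegative curvature gives a variance inequality for n points and any y: ∑ d(x_i, x_j)² ≤ 2n ∑
d(x_i, y)² (`HasCurvedMidpoints.sum_sq_dist_le`). No tangent cones or compactness are needed: y is
replaced by an almost maximal point of a penalized sum of squared distances, and a first-order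
variation there gives the bound.

On the cube, let E(A) be the energy of flipping the coordinates in A. The variance inequality for
the points x_{S_b ε}, centred at x_ε and summed over ε, bounds the energies E(S_b Δ S_b') by the
E(S_b). Let the S_b be m disjoint blocks of size k filling the coordinates. Averaging over
permutations leaves only cardinalities: (m - 1) E_{2k} ≤ 2m E_k (`permEnergy_double_le`). Doubling k
from 1 to 2ⁿ costs 2ⁿ ∏ (1 - 2⁻ʲ)⁻¹ ≤ 4 · 2ⁿ, so the constant does not depend on the dimension. -/

/-- Every pair of points has a midpoint at which the nonnegative curvature inequality holds. -/
def HasCurvedMidpoints (X : Type*) [MetricSpace X] : Prop :=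
  ∀ y z : X, ∃ m : X, dist y m = dist y z / 2 ∧ dist m z = dist y z / 2 ∧
    ∀ x : X, (1 / 2) * dist x y ^ 2 + (1 / 2) * dist x z ^ 2 - (1 / 4) * dist y z ^ 2
      ≤ dist x m ^ 2

/-! ### Constant-speed geodesics and their midpoints -/

section Geodesics

variable {X : Type*} [MetricSpace X]

theorem eVariationOn_of_dist_eq {σ : ℝ → X} {s : Set ℝ} {L : ℝ} (hL : 0 ≤ L)
    (hσ : ∀ u ∈ s, ∀ v ∈ s, dist (σ u) (σ v) = L * |u - v|) :
    eVariationOn σ s = eVariationOn (fun u => L * u) s := by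
  have key : ∀ u ∈ s, ∀ v ∈ s, edist (σ u) (σ v) = edist (L * u) (L * v) := by
    intro u hu v hv
    rw [edist_dist, edist_dist, hσ u hu v hv, Real.dist_eq, ← mul_sub, abs_mul, abs_of_nonneg hL]
  unfold eVariationOn
  refine iSup_congr fun p => Finset.sum_congr rfl fun i _ => ?_
  exact key _ (p.2.2.2 _) _ (p.2.2.2 _)

theorem eVariationOn_Icc_of_dist_eq {σ : ℝ → X} {L a b : ℝ} (hL : 0 ≤ L) (hab : a ≤ b)
    (hσ : ∀ u ∈ Set.Icc a b, ∀ v ∈ Set.Icc a b, dist (σ u) (σ v) = L * |u - v|) :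
    eVariationOn σ (Set.Icc a b) = ENNReal.ofReal (L * (b - a)) := by
  rw [eVariationOn_of_dist_eq hL hσ]
  have hm : MonotoneOn (fun u => L * u) (Set.Icc a b) :=
    fun u _ v _ huv => mul_le_mul_of_nonneg_left huv hL
  have ha : a ∈ Set.Icc a b := Set.left_mem_Icc.2 hab
  have hb : b ∈ Set.Icc a b := Set.right_mem_Icc.2 hab
  have := hm.eVariationOn_eq ha hb
  rwa [Set.inter_self, ← mul_sub] at this

theorem isMinimalGeodesic_of_dist_eq {σ : ℝ → X} {L : ℝ} (hL : 0 ≤ L)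
    (hσ : ∀ u ∈ Set.Icc (0 : ℝ) 1, ∀ v ∈ Set.Icc (0 : ℝ) 1, dist (σ u) (σ v) = L * |u - v|) :
    IsMinimalGeodesic σ := by
  have hsub : ∀ a ∈ Set.Icc (0 : ℝ) 1, ∀ b ∈ Set.Icc (0 : ℝ) 1, a ≤ b →
      eVariationOn σ (Set.Icc a b) = ENNReal.ofReal (L * (b - a)) := by
    intro a ha b hb hab
    have h := Set.Icc_subset_Icc ha.1 hb.2
    exact eVariationOn_Icc_of_dist_eq hL hab fun u hu v hv => hσ u (h hu) v (h hv)
  have hmin : ∀ a ∈ Set.Icc (0 : ℝ) 1, ∀ b ∈ Set.Icc (0 : ℝ) 1, a ≤ b →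
      eVariationOn σ (Set.Icc a b) = edist (σ a) (σ b) := by
    intro a ha b hb hab
    rw [hsub a ha b hb hab, edist_dist, hσ a ha b hb, abs_sub_comm,
      abs_of_nonneg (sub_nonneg.2 hab)]
  have h0 : (0 : ℝ) ∈ Set.Icc (0 : ℝ) 1 := by simp
  have h1 : (1 : ℝ) ∈ Set.Icc (0 : ℝ) 1 := by simp
  refine ⟨⟨?_, ?_, ?_, ?_⟩, hmin 0 h0 1 h1 zero_le_one⟩
  · have : LipschitzOnWith L.toNNReal σ (Set.Icc 0 1) := by
      refine LipschitzOnWith.of_dist_le_mul fun u hu v hv => ?_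
      rw [hσ u hu v hv, Real.coe_toNNReal _ hL, Real.dist_eq]
    exact this.continuousOn
  · rw [curveLength, hsub 0 h0 1 h1 zero_le_one]
    exact ENNReal.ofReal_ne_top
  · intro t _
    exact ⟨1, one_pos, fun a ha b hb _ _ hab => hmin a ha b hb hab⟩
  · refine ⟨L.toNNReal, hasConstantSpeedOnWith_iff_ordered.2 fun a ha b hb hab => ?_⟩
    have h : Set.Icc (0 : ℝ) 1 ∩ Set.Icc a b = Set.Icc a b :=
      Set.inter_eq_right.2 (Set.Icc_subset_Icc ha.1 hb.2)
    rw [h, hsub a ha b hb hab, Real.coe_toNNReal _ hL]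

/-- Along a curve whose length is the distance of its endpoints, the distance from the initial
point is additive. -/
theorem dist_add_dist_eq_of_curveLength_eq {γ : ℝ → X}
    (h : curveLength γ = edist (γ 0) (γ 1)) {a b : ℝ} (ha : 0 ≤ a) (hab : a ≤ b) (hb : b ≤ 1) :
    dist (γ 0) (γ a) + dist (γ a) (γ b) = dist (γ 0) (γ b) := by
  have h0a : edist (γ 0) (γ a) ≤ eVariationOn γ (Set.Icc 0 a) :=
    eVariationOn.edist_le γ (Set.left_mem_Icc.2 ha) (Set.right_mem_Icc.2 ha)
  have hab' : edist (γ a) (γ b) ≤ eVariationOn γ (Set.Icc a b) :=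
    eVariationOn.edist_le γ (Set.left_mem_Icc.2 hab) (Set.right_mem_Icc.2 hab)
  have hb1 : edist (γ b) (γ 1) ≤ eVariationOn γ (Set.Icc b 1) :=
    eVariationOn.edist_le γ (Set.left_mem_Icc.2 hb) (Set.right_mem_Icc.2 hb)
  have e1 := eVariationOn.Icc_add_Icc γ (s := Set.univ) ha hab (Set.mem_univ a)
  have e2 := eVariationOn.Icc_add_Icc γ (s := Set.univ) (ha.trans hab) hb (Set.mem_univ b)
  simp only [Set.univ_inter] at e1 e2
  have key : edist (γ 0) (γ a) + edist (γ a) (γ b) + edist (γ b) (γ 1) ≤ edist (γ 0) (γ 1) := by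
    rw [← h, curveLength, ← e2, ← e1]
    gcongr
  rw [edist_dist, edist_dist, edist_dist, edist_dist, ← ENNReal.ofReal_add (by positivity)
    (by positivity), ← ENNReal.ofReal_add (by positivity) (by positivity),
    ENNReal.ofReal_le_ofReal_iff dist_nonneg] at key
  have t1 := dist_triangle (γ 0) (γ b) (γ 1)
  have t2 := dist_triangle (γ 0) (γ a) (γ b)
  linarith

/-- Reparametrizes a shortest curve by distance from its start, which supplies the constant speed
required of a minimal geodesic. -/
theorem IsGeodesicSpace.exists_dist_eq (hX : IsGeodesicSpace X) (y z : X) :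
    ∃ σ : ℝ → X, σ 0 = y ∧ σ 1 = z ∧ ∀ u ∈ Set.Icc (0 : ℝ) 1, ∀ v ∈ Set.Icc (0 : ℝ) 1,
      dist (σ u) (σ v) = dist y z * |u - v| := by
  obtain ⟨γ, hγ, rfl, rfl, hlen⟩ := hX y z
  set L := dist (γ 0) (γ 1) with hL
  have hex : ∀ u ∈ Set.Icc (0 : ℝ) 1, ∃ t ∈ Set.Icc (0 : ℝ) 1, dist (γ 0) (γ t) = L * u := by
    intro u hu
    have hc : ContinuousOn (fun t => dist (γ 0) (γ t)) (Set.Icc 0 1) :=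
      (continuous_const.dist continuous_id).comp_continuousOn hγ
    have := intermediate_value_Icc zero_le_one hc
    have hm : L * u ∈ Set.Icc (dist (γ 0) (γ 0)) (dist (γ 0) (γ 1)) := by
      rw [dist_self]
      exact ⟨mul_nonneg dist_nonneg hu.1, mul_le_of_le_one_right dist_nonneg hu.2⟩
    exact this hm
  -- The parameters `t u` need be neither monotone nor continuous in `u`: distances along γ depend
  -- only on distances from `γ 0`.
  choose! t ht hd using hex
  have h0 : (0 : ℝ) ∈ Set.Icc (0 : ℝ) 1 := by simp
  have h1 : (1 : ℝ) ∈ Set.Icc (0 : ℝ) 1 := by simp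
  have hdist : ∀ a ∈ Set.Icc (0 : ℝ) 1, ∀ b ∈ Set.Icc (0 : ℝ) 1,
      dist (γ a) (γ b) = |dist (γ 0) (γ a) - dist (γ 0) (γ b)| := by
    intro a ha b hb
    rcases le_total a b with hab | hab
    · rw [← dist_add_dist_eq_of_curveLength_eq hlen ha.1 hab hb.2]
      simp
    · rw [← dist_add_dist_eq_of_curveLength_eq hlen hb.1 hab ha.2]
      simp [dist_comm]
  refine ⟨fun u => γ (t u), ?_, ?_, ?_⟩
  · have := hd 0 h0
    rw [mul_zero, dist_eq_zero] at this
    exact this.symm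
  · have := hdist _ (ht 1 h1) _ h1
    rw [hd 1 h1, mul_one, ← hL, sub_self, abs_zero, dist_eq_zero] at this
    exact this
  · intro u hu v hv
    rw [hdist _ (ht u hu) _ (ht v hv), hd u hu, hd v hv, ← mul_sub, abs_mul,
      abs_of_nonneg dist_nonneg]

theorem IsAlexandrovNonneg.hasCurvedMidpoints (hX : IsAlexandrovNonneg X) :
    HasCurvedMidpoints X := by
  intro y z
  obtain ⟨σ, h0, h1, hσ⟩ := hX.isGeodesicSpace.exists_dist_eq y z
  have m0 : (0 : ℝ) ∈ Set.Icc (0 : ℝ) 1 := by simp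
  have m1 : (1 : ℝ) ∈ Set.Icc (0 : ℝ) 1 := by simp
  have mh : (1 / 2 : ℝ) ∈ Set.Icc (0 : ℝ) 1 := by constructor <;> norm_num
  refine ⟨σ (1 / 2), ?_, ?_, fun x => ?_⟩
  · rw [← h0, hσ 0 m0 _ mh, h0]
    norm_num [abs_of_pos]
    ring
  · rw [← h1, hσ _ mh 1 m1, h1]
    norm_num [abs_of_neg]
    ring
  · exact hX.midpoint_le x y z σ (isMinimalGeodesic_of_dist_eq dist_nonneg hσ) h0 h1

end Geodesics

/-! ### Comparison at dyadic points -/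

section Comparison

variable {X : Type*} [MetricSpace X]

/-- The nonnegative curvature inequality at the point dividing `[z, y]` in the ratio
`2⁻ᵏ : 1 - 2⁻ᵏ`. -/
theorem HasCurvedMidpoints.exists_dyadic (hX : HasCurvedMidpoints X) (k : ℕ) (z y : X) :
    ∃ q : X, dist z q = (1 / 2) ^ k * dist z y ∧ dist q y = (1 - (1 / 2) ^ k) * dist z y ∧
      ∀ x : X, (1 - (1 / 2) ^ k) * dist x z ^ 2 + (1 / 2) ^ k * dist x y ^ 2
        - (1 / 2) ^ k * (1 - (1 / 2) ^ k) * dist z y ^ 2 ≤ dist x q ^ 2 := by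
  induction k with
  | zero => exact ⟨y, by simp, by simp, fun x => by simp⟩
  | succ k ih =>
    obtain ⟨q, hzq, hqy, hq⟩ := ih
    -- Halving towards `z`: the comparison at `q` is substituted into the midpoint comparison for
    -- `z` and `q`.
    obtain ⟨m, hzm, hmq, hm⟩ := hX z q
    have e : ((1 : ℝ) / 2) ^ (k + 1) = (1 / 2) ^ k / 2 := by rw [pow_succ]; ring
    rw [e]
    generalize ((1 : ℝ) / 2) ^ k = t at *
    have h1 : dist z m = t / 2 * dist z y := by rw [hzm, hzq]; ring
    refine ⟨m, h1, le_antisymm ?_ ?_, fun x => ?_⟩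
    · have := dist_triangle m q y
      rw [hmq, hzq, hqy] at this
      linarith
    · have := dist_triangle z m y
      linarith
    · have h2 := hm x
      have h3 := hq x
      rw [hzq] at h2
      nlinarith

end Comparison

/-! ### The variance inequality -/

section VarianceInequality

variable {X : Type*} [MetricSpace X] {ι : Type*} [Fintype ι]

/-- The sum of the squared distances of a point to the members of a finite family. -/
noncomputable def sumSqDist (x : ι → X) (z : X) : ℝ := ∑ j, dist (x j) z ^ 2

theorem sumSqDist_nonneg (x : ι → X) (z : X) : 0 ≤ sumSqDist x z :=
  Finset.sum_nonneg fun _ _ => sq_nonneg _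

theorem le_sumSqDist_of_curved (x : ι → X) {s : ℝ} {z y q : X}
    (h : ∀ w : X, (1 - s) * dist w z ^ 2 + s * dist w y ^ 2
      - s * (1 - s) * dist z y ^ 2 ≤ dist w q ^ 2) :
    (1 - s) * sumSqDist x z + s * sumSqDist x y
      - Fintype.card ι * (s * (1 - s) * dist z y ^ 2) ≤ sumSqDist x q := by
  have := Finset.sum_le_sum fun j (_ : j ∈ Finset.univ) => h (x j)
  simp only [Finset.sum_sub_distrib, Finset.sum_add_distrib, ← Finset.mul_sum, Finset.sum_const,
    Finset.card_univ, nsmul_eq_mul] at this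
  unfold sumSqDist
  linarith

set_option maxHeartbeats 1000000 in
/-- Moving an almost maximal point `z` of `w ↦ sumSqDist x w - c * d(y, w)²` first towards `y` and
then towards the members of the family. -/
theorem sum_sq_dist_le_of_almost_maximal (hX : HasCurvedMidpoints X) (x : ι → X) (y z : X)
    {c : ℝ} (hc : 0 ≤ c) (k : ℕ)
    (hz : ∀ w, sumSqDist x w - c * dist w y ^ 2 ≤
      sumSqDist x z - c * dist z y ^ 2 + ((1 / 2) ^ k) ^ 4) :
    ∑ i, ∑ j, dist (x i) (x j) ^ 2 ≤ 2 * Fintype.card ι * sumSqDist x z +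
      (1 / 2) ^ k * (Fintype.card ι * (sumSqDist x z + Fintype.card ι * dist z y ^ 2 + 3)
        + c * (2 + Fintype.card ι * dist z y ^ 2 + sumSqDist x z)) := by
  -- With s = 2⁻ᵏ, `q` lies at fraction s² towards `y`, so replacing `z` by `q` costs o(s) in the
  -- lower bound. The points `p i` lie at fraction s from `q` towards `x i`. The tolerance s⁴ stays
  -- negligible after division by s².
  obtain ⟨q, hzq, hqy, hq⟩ := hX.exists_dyadic (2 * k) z y
  choose p hqp hpx hp using fun i => hX.exists_dyadic k q (x i)
  rw [show ((1 : ℝ) / 2) ^ (2 * k) = ((1 / 2) ^ k) ^ 2 by rw [← pow_mul, mul_comm]] at hzq hqy hq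
  have hs0 : (0 : ℝ) < (1 / 2) ^ k := by positivity
  have hs1 : ((1 : ℝ) / 2) ^ k ≤ 1 := pow_le_one₀ (by norm_num) (by norm_num)
  generalize ((1 : ℝ) / 2) ^ k = s at *
  set n : ℝ := (Fintype.card ι : ℝ) with hn
  have hn0 : 0 ≤ n := Nat.cast_nonneg _
  set D := ∑ i, ∑ j, dist (x i) (x j) ^ 2 with hD
  set a := sumSqDist x z with ha
  set b := sumSqDist x q with hb
  set ρ := dist z y with hρ
  have ha0 : 0 ≤ a := sumSqDist_nonneg x z
  have hb0 : 0 ≤ b := sumSqDist_nonneg x q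
  have hs2 : s ^ 2 ≤ 1 := pow_le_one₀ hs0.le hs1
  have hs2' : s ^ 2 ≤ s := by nlinarith
  have hs4 : s ^ 4 ≤ s ^ 2 := by nlinarith [sq_nonneg s]
  -- the value at `q`
  have hbl : (1 - s ^ 2) * a - n * (s ^ 2 * ρ ^ 2) ≤ b := by
    have h1 := le_sumSqDist_of_curved x hq
    have h2 : 0 ≤ s ^ 2 * sumSqDist x y := mul_nonneg (sq_nonneg _) (sumSqDist_nonneg x y)
    have h3 : n * (s ^ 2 * (1 - s ^ 2) * ρ ^ 2) ≤ n * (s ^ 2 * ρ ^ 2) := by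
      gcongr
      nlinarith [sq_nonneg s]
    linarith
  have hbu : b ≤ a - c * (ρ ^ 2 - (1 - s ^ 2) ^ 2 * ρ ^ 2) + s ^ 4 := by
    have := hz q
    rw [hqy, mul_pow] at this
    linarith
  have hba : b ≤ a + s ^ 4 := by
    have : 0 ≤ c * (ρ ^ 2 - (1 - s ^ 2) ^ 2 * ρ ^ 2) := by
      apply mul_nonneg hc
      have : (1 - s ^ 2) ^ 2 ≤ 1 := by nlinarith [sq_nonneg s]
      nlinarith [sq_nonneg ρ]
    linarith
  -- lower bound for the values at the points `p i`
  have hlow : (1 - s) ^ 2 * (n * b) + s * D ≤ ∑ i, sumSqDist x (p i) := by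
    have h := Finset.sum_le_sum fun i (_ : i ∈ Finset.univ) => le_sumSqDist_of_curved x (hp i)
    simp only [Finset.sum_sub_distrib, Finset.sum_add_distrib, ← Finset.mul_sum, Finset.sum_const,
      Finset.card_univ, nsmul_eq_mul, ← hn] at h
    have e1 : ∑ i, sumSqDist x (x i) = D := by
      simp only [sumSqDist, hD]
      exact Finset.sum_comm
    have e2 : ∑ i, dist q (x i) ^ 2 = b := by simp only [hb, sumSqDist, dist_comm q]
    rw [e1, e2, ← hb] at h
    linarith
  -- upper bound for the distances of the `p i` from `y`
  have hdist : ∀ i, s ^ 2 * dist (p i) y ^ 2 ≤ s ^ 2 * dist (x i) q ^ 2 * s ^ 2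
      + s * (1 - s ^ 2) * (dist (x i) q ^ 2 - dist (x i) z ^ 2)
      + s ^ 2 * (1 - s ^ 2) ^ 2 * ρ ^ 2 + s * (s ^ 2 * s ^ 2) * (1 - s ^ 2) * ρ ^ 2 := by
    intro i
    have h1 := hq (p i)
    have h2 := hp i z
    rw [dist_comm (p i) q, hqp, dist_comm (p i) z, mul_pow] at h1
    rw [hzq, mul_pow] at h2
    rw [dist_comm z (x i)] at h2
    rw [dist_comm q (x i)] at h1 h2
    have h3 := mul_le_mul_of_nonneg_left h2 (show 0 ≤ 1 - s ^ 2 by linarith)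
    nlinarith
  have hdistsum : ∑ i, dist (p i) y ^ 2 ≤ s ^ 2 * b + n * ρ ^ 2 + s * s ^ 2 + n * s * s ^ 2 * ρ ^ 2 := by
    have h := Finset.sum_le_sum fun i (_ : i ∈ Finset.univ) => hdist i
    simp only [Finset.sum_sub_distrib, Finset.sum_add_distrib, ← Finset.mul_sum, Finset.sum_const,
      Finset.card_univ, nsmul_eq_mul, ← hn, ← Finset.sum_mul] at h
    have e1 : ∑ i, dist (x i) q ^ 2 = b := rfl
    have e2 : ∑ i, dist (x i) z ^ 2 = a := rfl
    rw [e1, e2] at h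
    have hs2p : 0 < s ^ 2 := by positivity
    refine le_of_mul_le_mul_left (h.trans ?_) hs2p
    -- The dangerous first-order term sums to a multiple of `b - a`, which almost maximality
    -- controls.
    have g1 : s * (1 - s ^ 2) * (b - a) ≤ s * s ^ 4 := by
      have : (1 - s ^ 2) * (b - a) ≤ s ^ 4 := by
        have : (1 - s ^ 2) * (b - a) ≤ (1 - s ^ 2) * s ^ 4 :=
          mul_le_mul_of_nonneg_left (by linarith) (by linarith)
        nlinarith [sq_nonneg s, sq_nonneg (s ^ 2)]
      rw [mul_assoc]
      gcongr
    have g2 : n * (s ^ 2 * (1 - s ^ 2) ^ 2 * ρ ^ 2) ≤ n * (s ^ 2 * 1 * ρ ^ 2) := by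
      gcongr
      nlinarith [sq_nonneg s]
    have g3 : n * (s * (s ^ 2 * s ^ 2) * (1 - s ^ 2) * ρ ^ 2) ≤
        n * (s * (s ^ 2 * s ^ 2) * 1 * ρ ^ 2) := by
      gcongr
      nlinarith [sq_nonneg s]
    linarith
  have hup : ∑ i, sumSqDist x (p i) - c * ∑ i, dist (p i) y ^ 2 ≤ n * (a - c * ρ ^ 2 + s ^ 4) := by
    have h := Finset.sum_le_sum fun i (_ : i ∈ Finset.univ) => hz (p i)
    simpa only [Finset.sum_sub_distrib, ← Finset.mul_sum, Finset.sum_const,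
      Finset.card_univ, nsmul_eq_mul, ← hn] using h
  have hcd := mul_le_mul_of_nonneg_left hdistsum hc
  -- The penalty terms `n * c * ρ ^ 2` cancel, leaving 2s·n·a as the leading term on the right.
  have hmain : s * D ≤ n * (a - (1 - s) ^ 2 * b) + c * (s ^ 2 * b + s * s ^ 2
      + n * s * s ^ 2 * ρ ^ 2) + n * s ^ 4 := by linarith
  refine le_of_mul_le_mul_left (hmain.trans ?_) hs0
  have k1 : a - (1 - s) ^ 2 * b ≤ s ^ 2 * a + n * (s ^ 2 * ρ ^ 2) + 2 * s * a + 2 * s ^ 2 := by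
    have : s * b ≤ s * a + s ^ 2 := by
      have := mul_le_mul_of_nonneg_left hba hs0.le
      nlinarith [sq_nonneg s]
    nlinarith [mul_nonneg (sq_nonneg s) hb0]
  have k2 : s ^ 2 * b + s * s ^ 2 + n * s * s ^ 2 * ρ ^ 2 ≤
      s ^ 2 * (a + 1) + s ^ 2 + n * s ^ 2 * ρ ^ 2 := by
    have t1 : s ^ 2 * b ≤ s ^ 2 * (a + 1) := by gcongr; linarith
    have t2 : s * s ^ 2 ≤ 1 * s ^ 2 := by gcongr
    have t3 : n * s * s ^ 2 * ρ ^ 2 ≤ n * 1 * s ^ 2 * ρ ^ 2 := by gcongr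
    linarith
  have k3 := mul_le_mul_of_nonneg_left k1 hn0
  have k4 := mul_le_mul_of_nonneg_left k2 hc
  have k5 := mul_le_mul_of_nonneg_left hs4 hn0
  linarith

theorem sumSqDist_le (x : ι → X) (y w : X) {κ : ℝ} (hκ : 0 < κ) :
    sumSqDist x w ≤ (1 + κ) * sumSqDist x y + (1 + κ⁻¹) * Fintype.card ι * dist w y ^ 2 := by
  have h : ∀ j ∈ Finset.univ, dist (x j) w ^ 2 ≤
      (1 + κ) * dist (x j) y ^ 2 + (1 + κ⁻¹) * dist w y ^ 2 := by
    intro j _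
    have h1 : dist (x j) w ^ 2 ≤ (dist (x j) y + dist w y) ^ 2 := by
      gcongr
      exact dist_triangle_right _ _ _
    have h2 : 0 ≤ κ⁻¹ * (κ * dist (x j) y - dist w y) ^ 2 := by positivity
    have h3 : κ⁻¹ * (κ * dist (x j) y - dist w y) ^ 2 =
        κ * dist (x j) y ^ 2 - 2 * (dist (x j) y * dist w y) + κ⁻¹ * dist w y ^ 2 := by
      field_simp
      ring
    linarith
  refine (Finset.sum_le_sum h).trans_eq ?_
  simp only [Finset.sum_add_distrib, ← Finset.mul_sum, Finset.sum_const, Finset.card_univ,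
    nsmul_eq_mul, sumSqDist]
  ring

/-- The penalty dominates the quadratic growth of `sumSqDist`, so the supremum is finite. It need
not be attained, hence the tolerance η. -/
theorem exists_almost_maximal (x : ι → X) (y : X) {c κ η : ℝ} (hκ : 0 < κ) (hη : 0 < η)
    (hc : (1 + κ⁻¹) * Fintype.card ι ≤ c) :
    ∃ z, sumSqDist x y - η ≤ sumSqDist x z - c * dist z y ^ 2 ∧
      ∀ w, sumSqDist x w - c * dist w y ^ 2 ≤ sumSqDist x z - c * dist z y ^ 2 + η := by
  set G : X → ℝ := fun w => sumSqDist x w - c * dist w y ^ 2 with hG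
  have hbdd : BddAbove (Set.range G) := by
    refine ⟨(1 + κ) * sumSqDist x y, ?_⟩
    rintro _ ⟨w, rfl⟩
    have h1 := sumSqDist_le x y w hκ
    have h2 := mul_le_mul_of_nonneg_right hc (sq_nonneg (dist w y))
    simp only [hG]
    linarith
  have : Nonempty X := ⟨y⟩
  obtain ⟨z, hz⟩ := exists_lt_of_lt_ciSup (sub_lt_self (iSup G) hη)
  have hw : ∀ w, G w ≤ G z + η := fun w => by
    have := le_ciSup hbdd w
    linarith
  refine ⟨z, ?_, hw⟩
  have := hw y
  simp only [hG, dist_self] at this ⊢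
  linarith

/-- The inequality of Lang, Schroeder and Sturm, for equal weights. -/
theorem HasCurvedMidpoints.sum_sq_dist_le (hX : HasCurvedMidpoints X) (x : ι → X) (y : X) :
    ∑ i, ∑ j, dist (x i) (x j) ^ 2 ≤ 2 * Fintype.card ι * ∑ i, dist (x i) y ^ 2 := by
  rcases isEmpty_or_nonempty ι with hι | hι
  · simp
  change _ ≤ 2 * Fintype.card ι * sumSqDist x y
  set D := ∑ i, ∑ j, dist (x i) (x j) ^ 2 with hD
  set n : ℝ := (Fintype.card ι : ℝ) with hn
  set F := sumSqDist x y with hF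
  have hF0 : 0 ≤ F := sumSqDist_nonneg x y
  have hn1 : 1 ≤ n := Nat.one_le_cast.2 Fintype.card_pos
  have main : ∀ κ : ℝ, 0 < κ → D ≤ 2 * n * ((1 + 2 * κ) * F) := by
    intro κ hκ
    -- Twice the coefficient needed for boundedness: the spare half bounds `dist z y` and gives
    -- `sumSqDist x z ≤ (1 + 2 * κ) * F + s`.
    set c := 2 * ((1 + κ⁻¹) * n) with hc
    have hκn : 1 ≤ (1 + κ⁻¹) * n := by
      have : 0 < κ⁻¹ := inv_pos.2 hκ
      nlinarith
    have hc0 : 0 ≤ c := by linarith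
    set A := (1 + 2 * κ) * F with hA
    set B := κ * F + 1 with hB
    have hκF : 0 ≤ κ * F := by positivity
    have step : ∀ k : ℕ, D ≤ 2 * n * A +
        (1 / 2) ^ k * (2 * n + n * ((A + 1) + n * B + 3) + c * (2 + n * B + (A + 1))) := by
      intro k
      have hs0 : (0 : ℝ) < (1 / 2) ^ k := by positivity
      have hs1 : ((1 : ℝ) / 2) ^ k ≤ 1 := pow_le_one₀ (by norm_num) (by norm_num)
      obtain ⟨z, hzy, hz⟩ := exists_almost_maximal x y (c := c) hκ
        (show 0 < (((1 : ℝ) / 2) ^ k) ^ 4 by positivity) (by linarith)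
      have h := sum_sq_dist_le_of_almost_maximal hX x y z hc0 k hz
      have hle := sumSqDist_le x y z hκ
      rw [← hF, ← hn] at *
      rw [← hD] at h
      generalize ((1 : ℝ) / 2) ^ k = s at *
      have hs4 : s ^ 4 ≤ s := by
        have := pow_le_pow_of_le_one hs0.le hs1 (show 1 ≤ 4 by norm_num)
        simpa using this
      have hρ1 : (1 + κ⁻¹) * n * dist z y ^ 2 ≤ κ * F + s := by
        rw [hc] at hzy
        linarith
      have hρ2 : dist z y ^ 2 ≤ B := by
        have := mul_le_mul_of_nonneg_right hκn (sq_nonneg (dist z y))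
        linarith
      have hz1 : sumSqDist x z ≤ A + s := by rw [hA]; linarith
      have hz2 : sumSqDist x z ≤ A + 1 := by linarith
      have hn0 : 0 ≤ n := by linarith
      calc D ≤ _ := h
        _ ≤ 2 * n * (A + s) + s * (n * ((A + 1) + n * B + 3) + c * (2 + n * B + (A + 1))) := by
          gcongr
        _ = _ := by ring
    have hlim : Filter.Tendsto (fun k : ℕ => 2 * n * A +
        ((1 : ℝ) / 2) ^ k * (2 * n + n * ((A + 1) + n * B + 3) + c * (2 + n * B + (A + 1))))
        Filter.atTop (nhds (2 * n * A + 0 * (2 * n + n * ((A + 1) + n * B + 3)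
          + c * (2 + n * B + (A + 1))))) :=
      ((tendsto_pow_atTop_nhds_zero_of_lt_one (by norm_num) (by norm_num)).mul_const _).const_add _
    have := ge_of_tendsto' hlim step
    linarith
  refine le_of_forall_pos_le_add fun ε hε => ?_
  have hpos : 0 < 4 * n * F + 1 := by positivity
  refine (main (ε / (4 * n * F + 1)) (by positivity)).trans ?_
  have : ε / (4 * n * F + 1) * (4 * n * F) ≤ ε := by
    rw [div_mul_eq_mul_div, div_le_iff₀ hpos]
    nlinarith
  linarith

end VarianceInequality

/-! ### Energies of coordinate flips -/

section Cube

variable {X : Type*} [MetricSpace X] {ι : Type*} [DecidableEq ι]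

/-- The element of the cube group whose coordinates are `-1` exactly on `A`. -/
def cubeFlip (A : Finset ι) : ι → ℤˣ := fun i => if i ∈ A then -1 else 1

theorem cubeFlip_symmDiff (A B : Finset ι) :
    cubeFlip (symmDiff A B) = cubeFlip A * cubeFlip B := by
  funext i
  by_cases hA : i ∈ A <;> by_cases hB : i ∈ B <;>
    simp [cubeFlip, Finset.mem_symmDiff, hA, hB]

theorem cubeFlip_mul_self (A : Finset ι) : cubeFlip A * cubeFlip A = 1 := by
  rw [← cubeFlip_symmDiff, symmDiff_self]
  funext i
  simp [cubeFlip]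

variable [Fintype ι]

/-- The sum of `d(x_{gε}, x_ε)²` over the cube, where `g` flips the coordinates in `A`. -/
noncomputable def cubeEnergy (x : (ι → ℤˣ) → X) (A : Finset ι) : ℝ :=
  ∑ ε, dist (x (cubeFlip A * ε)) (x ε) ^ 2

theorem cubeEnergy_nonneg (x : (ι → ℤˣ) → X) (A : Finset ι) : 0 ≤ cubeEnergy x A :=
  Finset.sum_nonneg fun _ _ => sq_nonneg _

theorem cubeEnergy_symmDiff (x : (ι → ℤˣ) → X) (A B : Finset ι) :
    cubeEnergy x (symmDiff A B) = ∑ ε, dist (x (cubeFlip A * ε)) (x (cubeFlip B * ε)) ^ 2 := by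
  unfold cubeEnergy
  rw [← Equiv.sum_comp (Equiv.mulLeft (cubeFlip B))]
  refine Finset.sum_congr rfl fun ε _ => ?_
  rw [Equiv.coe_mulLeft, cubeFlip_symmDiff, mul_assoc, ← mul_assoc (cubeFlip B),
    cubeFlip_mul_self, one_mul]

theorem sum_cubeEnergy_symmDiff_le (hX : HasCurvedMidpoints X) {β : Type*} [Fintype β]
    (x : (ι → ℤˣ) → X) (S : β → Finset ι) :
    ∑ b, ∑ b', cubeEnergy x (symmDiff (S b) (S b')) ≤
      2 * Fintype.card β * ∑ b, cubeEnergy x (S b) := by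
  have h := Finset.sum_le_sum fun ε (_ : ε ∈ Finset.univ) =>
    hX.sum_sq_dist_le (fun b => x (cubeFlip (S b) * ε)) (x ε)
  rw [← Finset.mul_sum, Finset.sum_comm] at h
  simp only [cubeEnergy_symmDiff]
  refine le_trans (le_of_eq (Finset.sum_congr rfl fun b _ => Finset.sum_comm)) (h.trans_eq ?_)
  rw [Finset.sum_comm]
  rfl

/-- The sum of the energies of all images of `A` under permutations of the coordinates. -/
noncomputable def permEnergy (x : (ι → ℤˣ) → X) (A : Finset ι) : ℝ :=
  ∑ σ : Equiv.Perm ι, cubeEnergy x (A.map σ.toEmbedding)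

theorem permEnergy_nonneg (x : (ι → ℤˣ) → X) (A : Finset ι) : 0 ≤ permEnergy x A :=
  Finset.sum_nonneg fun _ _ => cubeEnergy_nonneg _ _

/-- A bijection from `A` to `B` extends to a permutation, and translating by it preserves the sum
over all permutations. -/
theorem permEnergy_congr_card (x : (ι → ℤˣ) → X) {A B : Finset ι} (h : A.card = B.card) :
    permEnergy x A = permEnergy x B := by
  let e : {i // i ∈ A} ≃ {i // i ∈ B} := Finset.equivOfCardEq h
  let τ : Equiv.Perm ι := e.extendSubtype
  have hτ : A.map τ.toEmbedding = B := by
    refine Finset.eq_of_subset_of_card_le ?_ (by rw [Finset.card_map, h])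
    intro j hj
    obtain ⟨i, hi, rfl⟩ := Finset.mem_map.1 hj
    exact e.extendSubtype_mem i hi
  unfold permEnergy
  rw [← Equiv.sum_comp (Equiv.mulRight τ)]
  refine Finset.sum_congr rfl fun σ _ => ?_
  rw [← hτ, Finset.map_map]
  rfl

theorem permEnergy_double_le (hX : HasCurvedMidpoints X) (x : (ι → ℤˣ) → X) {m k : ℕ}
    (hm : 0 < m) (hι : Fintype.card ι = m * k) {A B : Finset ι} (hA : A.card = k)
    (hB : B.card = 2 * k) :
    ((m : ℝ) - 1) * permEnergy x B ≤ 2 * m * permEnergy x A := by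
  let e : ι ≃ Fin m × Fin k := Fintype.equivOfCardEq (by simp [hι])
  let S : Fin m → Finset ι := fun b =>
    Finset.univ.map ⟨fun j => e.symm (b, j), fun i j hij => by simpa using hij⟩
  have hS : ∀ b, (S b).card = k := fun b => by simp [S]
  have hdisj : ∀ b b', b ≠ b' → Disjoint (S b) (S b') := by
    intro b b' hb
    rw [Finset.disjoint_left]
    intro i hi hi'
    obtain ⟨j, -, rfl⟩ := Finset.mem_map.1 hi
    obtain ⟨j', -, h⟩ := Finset.mem_map.1 hi'
    have h' : e.symm (b', j') = e.symm (b, j) := h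
    rw [e.symm.apply_eq_iff_eq] at h'
    exact hb (Prod.ext_iff.1 h').1.symm
  have hpair : ∀ b b', b ≠ b' → permEnergy x (symmDiff (S b) (S b')) = permEnergy x B := by
    intro b b' hb
    refine permEnergy_congr_card x ?_
    rw [(hdisj b b' hb).symmDiff_eq_sup, Finset.sup_eq_union,
      Finset.card_union_of_disjoint (hdisj b b' hb), hS, hS, hB, two_mul]
  have hsum : ∑ b, ∑ b', permEnergy x (symmDiff (S b) (S b')) ≤
      2 * m * ∑ b, permEnergy x (S b) := by
    have h := Finset.sum_le_sum fun σ (_ : σ ∈ (Finset.univ : Finset (Equiv.Perm ι))) =>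
      sum_cubeEnergy_symmDiff_le hX x fun b => (S b).map σ.toEmbedding
    rw [← Finset.mul_sum, Fintype.card_fin, Finset.sum_comm] at h
    unfold permEnergy
    refine le_trans (le_of_eq (Finset.sum_congr rfl fun b _ => ?_)) (h.trans_eq ?_)
    · rw [Finset.sum_comm]
      simp only [Finset.map_eq_image, Equiv.coe_toEmbedding,
        Finset.image_symmDiff _ _ (Equiv.injective _)]
    · rw [Finset.sum_comm]
  have hright : ∑ b, permEnergy x (S b) = m * permEnergy x A := by
    simp [fun b => permEnergy_congr_card x ((hS b).trans hA.symm)]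
  have hleft : m * (((m : ℝ) - 1) * permEnergy x B) ≤
      ∑ b, ∑ b', permEnergy x (symmDiff (S b) (S b')) := by
    have h : ∀ b ∈ (Finset.univ : Finset (Fin m)), ((m : ℝ) - 1) * permEnergy x B ≤
        ∑ b', permEnergy x (symmDiff (S b) (S b')) := by
      intro b _
      calc ((m : ℝ) - 1) * permEnergy x B
          = ∑ b' ∈ Finset.univ.erase b, permEnergy x (symmDiff (S b) (S b')) := by
            rw [Finset.sum_congr rfl fun b' hb' => hpair b b' (Finset.ne_of_mem_erase hb').symm]
            simp [Finset.card_erase_of_mem, Nat.cast_sub hm]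
        _ ≤ _ := Finset.sum_le_sum_of_subset_of_nonneg (Finset.subset_univ _)
            fun _ _ _ => permEnergy_nonneg _ _
    simpa using Finset.sum_le_sum h
  have hm' : (0 : ℝ) < m := by exact_mod_cast hm
  rw [hright] at hsum
  exact le_of_mul_le_mul_left (by linarith) hm'

/-- The factor 1/4 + 2⁻ⁱ/4 is a closed lower bound for ∏ (1 - 2⁻ʲ) over 1 ≤ j ≤ i + 1. It survives
induction because (1 - u/4)(1/4 + u/4) ≥ 1/4 + u/8 for u = 2⁻ⁱ ≤ 1. -/
theorem permEnergy_univ_mul_le (hX : HasCurvedMidpoints X) (x : (ι → ℤˣ) → X) {n : ℕ}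
    (hι : Fintype.card ι = 2 ^ n) (i : ℕ) (hi : i + 1 ≤ n) (A : Finset ι)
    (hA : A.card = 2 ^ (n - (i + 1))) :
    permEnergy x Finset.univ * (1 / 4 + (1 / 2) ^ i / 4) ≤ 2 ^ (i + 1) * permEnergy x A := by
  induction i generalizing A with
  | zero =>
    have hn : 2 ^ n = 2 * 2 ^ (n - (0 + 1)) := by rw [← pow_succ']; congr 1; omega
    have := permEnergy_double_le hX x two_pos (hι.trans hn) hA
      (B := Finset.univ) (by rw [Finset.card_univ, hι, hn])
    norm_num at this ⊢
    linarith
  | succ i ih =>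
    have hk : 2 ^ (n - (i + 1)) = 2 * 2 ^ (n - (i + 1 + 1)) := by
      rw [← pow_succ']; congr 1; omega
    obtain ⟨B, -, hB⟩ := Finset.exists_subset_card_eq (s := (Finset.univ : Finset ι))
      (n := 2 ^ (n - (i + 1)))
      (by rw [Finset.card_univ, hι]; exact Nat.pow_le_pow_right two_pos (Nat.sub_le _ _))
    have h1 := ih (by omega) B hB
    have h2 := permEnergy_double_le hX x (m := 2 ^ (i + 1 + 1)) (by positivity)
      (hι.trans (by rw [← pow_add]; congr 1; omega)) hA (hB.trans hk)
    have hu0 : (0 : ℝ) < (1 / 2) ^ i := by positivity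
    have hu1 : ((1 : ℝ) / 2) ^ i ≤ 1 := pow_le_one₀ (by norm_num) (by norm_num)
    have hu : (2 : ℝ) ^ i * (1 / 2) ^ i = 1 := by rw [← mul_pow]; norm_num
    have hU := permEnergy_nonneg x (Finset.univ : Finset ι)
    push_cast at h2
    rw [pow_succ (2 : ℝ), pow_succ (2 : ℝ)] at h2 ⊢
    rw [pow_succ (2 : ℝ)] at h1
    rw [pow_succ (1 / 2 : ℝ)]
    generalize ((1 : ℝ) / 2) ^ i = u at *
    generalize (2 : ℝ) ^ i = v at *
    have h3 : (1 - u / 4) * (permEnergy x Finset.univ * (1 / 4 + u / 4)) ≤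
        (1 - u / 4) * (v * 2 * permEnergy x B) :=
      mul_le_mul_of_nonneg_left h1 (by linarith)
    have h4 : (1 - u / 4) * (v * 2 * permEnergy x B) = (v * 2 * 2 - 1) * permEnergy x B / 2 := by
      linear_combination (-permEnergy x B / 2) * hu
    have h5 : permEnergy x Finset.univ * (1 / 4 + u * (1 / 2) / 4) ≤
        (1 - u / 4) * (permEnergy x Finset.univ * (1 / 4 + u / 4)) := by
      have : 0 ≤ permEnergy x (Finset.univ : Finset ι) * (u * (1 - u)) :=
        mul_nonneg hU (mul_nonneg hu0.le (by linarith))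
      linarith
    linarith

theorem permEnergy_univ_le (hX : HasCurvedMidpoints X) (x : (ι → ℤˣ) → X) {n : ℕ}
    (hι : Fintype.card ι = 2 ^ n) (i : ι) :
    permEnergy x Finset.univ ≤ 4 * 2 ^ n * permEnergy x {i} := by
  have hU := permEnergy_nonneg x (Finset.univ : Finset ι)
  rcases n with _ | n
  · rw [← permEnergy_congr_card x (A := Finset.univ) (B := {i}) (by simp [hι])]
    linarith
  · have h := permEnergy_univ_mul_le hX x hι n le_rfl {i} (by simp)
    have : 0 ≤ permEnergy x Finset.univ * (1 / 2 : ℝ) ^ n := by positivity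
    linarith

theorem cubeEnergy_univ_le_of_card_eq_two_pow (hX : HasCurvedMidpoints X) (x : (ι → ℤˣ) → X)
    {n : ℕ} (hι : Fintype.card ι = 2 ^ n) :
    cubeEnergy x Finset.univ ≤ 4 * ∑ i, cubeEnergy x {i} := by
  have h := Finset.sum_le_sum fun i (_ : i ∈ Finset.univ) => permEnergy_univ_le hX x hι i
  have h1 : permEnergy x (Finset.univ : Finset ι) =
      Fintype.card (Equiv.Perm ι) * cubeEnergy x Finset.univ := by
    simp [permEnergy]
  have h2 : ∑ i, permEnergy x {i} = Fintype.card (Equiv.Perm ι) * ∑ i, cubeEnergy x {i} := by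
    unfold permEnergy
    rw [Finset.sum_comm]
    simp only [Finset.map_singleton, Equiv.coe_toEmbedding]
    rw [Finset.sum_congr rfl fun σ _ => Equiv.sum_comp σ fun i => cubeEnergy x {i}]
    simp
  rw [← Finset.mul_sum, h2, h1, Finset.sum_const, Finset.card_univ, hι, nsmul_eq_mul] at h
  push_cast at h
  have hp : (0 : ℝ) < 2 ^ n * Fintype.card (Equiv.Perm ι) := by
    have : 0 < Fintype.card (Equiv.Perm ι) := Fintype.card_pos
    positivity
  exact le_of_mul_le_mul_left (by linarith) hp

theorem cubeEnergy_comp_inl {κ : Type*} [Fintype κ] [DecidableEq κ] (x : (ι → ℤˣ) → X)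
    (A : Finset (ι ⊕ κ)) :
    cubeEnergy (fun ε : ι ⊕ κ → ℤˣ => x (ε ∘ Sum.inl)) A =
      Fintype.card (κ → ℤˣ) * cubeEnergy x (A.preimage Sum.inl Sum.inl_injective.injOn) := by
  unfold cubeEnergy
  rw [← Equiv.sum_comp (Equiv.sumArrowEquivProdArrow ι κ ℤˣ).symm, Fintype.sum_prod_type]
  have : ∀ (ε : ι → ℤˣ) (δ : κ → ℤˣ),
      (cubeFlip A * (Equiv.sumArrowEquivProdArrow ι κ ℤˣ).symm (ε, δ)) ∘ Sum.inl =
        cubeFlip (A.preimage Sum.inl Sum.inl_injective.injOn) * ε := by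
    intro ε δ
    funext i
    simp [cubeFlip, Equiv.sumArrowEquivProdArrow]
  simp only [this]
  simp [Finset.mul_sum, Equiv.sumArrowEquivProdArrow, Function.comp_def]

/-- Dummy coordinates pad the dimension to a power of two. They multiply every energy by the same
factor, and flipping one alone costs nothing. -/
theorem cubeEnergy_univ_le (hX : HasCurvedMidpoints X) (x : (ι → ℤˣ) → X) :
    cubeEnergy x Finset.univ ≤ 4 * ∑ i, cubeEnergy x {i} := by
  set N := Fintype.card ι with hN
  have hle : N ≤ 2 ^ N := Nat.lt_two_pow_self.le
  have h := cubeEnergy_univ_le_of_card_eq_two_pow hX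
    (fun ε : ι ⊕ Fin (2 ^ N - N) → ℤˣ => x (ε ∘ Sum.inl)) (n := N)
    (by rw [Fintype.card_sum, Fintype.card_fin, ← hN]; omega)
  have e1 : (Finset.univ : Finset (ι ⊕ Fin (2 ^ N - N))).preimage Sum.inl
      Sum.inl_injective.injOn = Finset.univ := by ext; simp
  have e2 : ∀ i : ι, ({Sum.inl i} : Finset (ι ⊕ Fin (2 ^ N - N))).preimage Sum.inl
      Sum.inl_injective.injOn = {i} := by intro i; ext; simp
  have e3 : ∀ i, ({Sum.inr i} : Finset (ι ⊕ Fin (2 ^ N - N))).preimage Sum.inl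
      Sum.inl_injective.injOn = ∅ := by intro i; ext; simp
  have e4 : cubeEnergy x ∅ = 0 := by
    have : cubeFlip (∅ : Finset ι) = 1 := by funext i; simp [cubeFlip]
    simp [cubeEnergy, this]
  simp only [cubeEnergy_comp_inl, Fintype.sum_sum_type, e1, e2, e3, e4,
    Finset.sum_const_zero, add_zero, ← Finset.mul_sum] at h
  have hp : (0 : ℝ) < Fintype.card (Fin (2 ^ N - N) → ℤˣ) := by
    exact_mod_cast Fintype.card_pos
  exact le_of_mul_le_mul_left (by linarith) hp

end Cube

/-! ### Adjacency in the cube and Enflo type -/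

theorem cubeAdj_cubeFlip_mul {N : ℕ} (ε : Fin N → ℤˣ) (i : Fin N) :
    CubeAdj ε (cubeFlip {i} * ε) := by
  unfold CubeAdj
  rw [Finset.sum_eq_single i]
  · rcases Int.units_eq_one_or (ε i) with h | h <;> simp [cubeFlip, h]
  · intro j _ hj
    simp [cubeFlip, hj]
  · simp

theorem cubeFlip_singleton_mul_injective {N : ℕ} (ε : Fin N → ℤˣ) :
    Function.Injective fun i : Fin N => cubeFlip {i} * ε := by
  intro i j hij
  have h := congrFun (mul_right_cancel hij) i
  by_contra hne
  simp [cubeFlip, hne] at h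

theorem sum_cubeEnergy_singleton_le {X : Type*} [MetricSpace X] {N : ℕ}
    (x : (Fin N → ℤˣ) → X) :
    ∑ i, cubeEnergy x {i} ≤
      ∑ ε, ∑ ε', if CubeAdj ε ε' then dist (x ε) (x ε') ^ 2 else 0 := by
  unfold cubeEnergy
  rw [Finset.sum_comm]
  refine Finset.sum_le_sum fun ε _ => ?_
  rw [← Finset.sum_filter]
  calc ∑ i, dist (x (cubeFlip {i} * ε)) (x ε) ^ 2
      = ∑ ε' ∈ Finset.univ.map ⟨_, cubeFlip_singleton_mul_injective ε⟩,
          dist (x ε) (x ε') ^ 2 := by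
        rw [Finset.sum_map]
        exact Finset.sum_congr rfl fun i _ => by rw [dist_comm]; rfl
    _ ≤ _ := by
        refine Finset.sum_le_sum_of_subset_of_nonneg ?_ fun _ _ _ => sq_nonneg _
        intro ε' h
        obtain ⟨i, -, rfl⟩ := Finset.mem_map.1 h
        exact Finset.mem_filter.2 ⟨Finset.mem_univ _, cubeAdj_cubeFlip_mul ε i⟩

theorem corollary4p3 {X : Type*} [MetricSpace X] (hX : IsAlexandrovNonneg X) :
    HasEnfloTypeTwo X := by
  refine ⟨2, one_le_two, fun N x => ?_⟩
  have h1 := cubeEnergy_univ_le hX.hasCurvedMidpoints x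
  have h2 := sum_cubeEnergy_singleton_le x
  have h3 : cubeEnergy x Finset.univ = ∑ ε, dist (x ε) (x (-ε)) ^ 2 := by
    refine Finset.sum_congr rfl fun ε _ => ?_
    have : cubeFlip Finset.univ * ε = -ε := by
      funext i
      simp [cubeFlip]
    rw [this, dist_comm]
  rw [← h3]
  linarith
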